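/- Let $\Bbbk$ be a commutative ring (for instance a field of arbitrary characteristic). Definitions. A \emph{graded coalgebra} is a $\Bbbk$-coalgebra $C=\bigoplus_{n\ge0}C_n$ with $\Delta(C_n)\subseteq\sum_{i+j=n}C_i\otimes C_j$ and $\epsilon(C_n)=0$ for $n>0$. A \emph{combinatorial coalgebra} is a pair $(C,\zeta)$ of a graded coalgebra $C$ that is connected ($\epsilon$ restricts to a bijection $C_0\to\Bbbk$), with all $C_n$ finitely generated over $\Bbbk$, and a linear functional $\zeta\colon C\to\Bbbk$ that is normalized: $\zeta|_{C_0}=\epsilon|_{C_0}$. A \emph{combinatorial Hopf algebra} is a pair $(H,\zeta)$ of a Hopf algebra $H=\bigoplus_{n\ge0}H_n$ over $\Bbbk$ all of whose structure maps preserve the grading, with $H_0=\Bbbk\cdot1$ and all $H_n$ finitely generated over $\Bbbk$, and a morphism of algebras $\zeta\colon H\to\Bbbk$ (automatically normalized). Morphisms are the degree-preserving morphisms $\alpha$ of coalgebras (respectively, of Hopf algebras) with $\zeta=\zeta'\circ\alpha$. For a composition $\alpha=(a_1,\dots,a_r)$ (a finite sequence of positive integers) let $M_\alpha=\sum_{i_1<\cdots<i_r}x_{i_1}^{a_1}\cdots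 x_{i_r}^{a_r}$, a formal power series in $x_1,x_2,\dots$ over $\Bbbk$, and for a partition $\lambda$ let $m_\lambda=\sum_\alpha M_\alpha$, the sum over all distinct rearrangements $\alpha$ of $\lambda$. Let $\mathit{Sym}$ be the span of all $m_\lambda$. It is an algebra under multiplication of power series, is graded with $\mathit{Sym}_n$ spanned by the $m_\lambda$ with $|\lambda|=n$, and is a Hopf algebra with $\Delta(m_\lambda)=\sum_{\mu\cup\nu=\lambda}m_\mu\otimes m_\nu$ (the sum over all pairs of partitions whose multiset union is $\lambda$) and $\epsilon(m_\lambda)=1$ if $\lambda$ is empty, $0$ otherwise. Let $\zeta_S\colon\mathit{Sym}\to\Bbbk$ be the restriction to $\mathit{Sym}$ of the morphism of algebras $\zeta_{\mathcal Q}$, on power series of finite degree, that substitutes $x_1=1$ and $x_i=0$ for $i\ne1$. Theorem. (1) $(\mathit{Sym},\zeta_S)$ is a cocommutative combinatorial coalgebra and a cocommutative combinatorial Hopf algebra. (2) For every cocommutative combinatorial coalgebra $(C,\zeta)$ there is a unique morphism of combinatorial coalgebras $\Psi\colon(C,\zeta)\to(\mathit{Sym},\zeta_S)$. (3) For every cocommutative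 combinatorial Hopf algebra $(H,\zeta)$ there is a unique morphism of combinatorial Hopf algebras $\Psi\colon(H,\zeta)\to(\mathit{Sym},\zeta_S)$. Thus $(\mathit{Sym},\zeta_S)$ is the terminal object in the category of cocommutative combinatorial coalgebras and in that of cocommutative combinatorial Hopf algebras. -/

import Mathlib

open scoped TensorProduct

universe u v

namespace SymFun

section Shape

/-- The list of the nonzero exponents of a monomial `x ^ d` in the variables `x_0, x_1, x_2, …`,
read in increasing order of the variables.  (On the support of `d` the value `d i` is positive, so
`Nat.toPNat'` only records this positivity in the type.) -/
def exponents (d : ℕ →₀ ℕ) : List ℕ+ :=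
  (d.support.sort (· ≤ ·)).map fun i => (d i).toPNat'

/-- The multiset of the nonzero exponents of a monomial (in variables indexed by any type). -/
def shape {ι : Type*} (d : ι →₀ ℕ) : Multiset ℕ+ :=
  d.support.val.map fun i => (d i).toPNat'

lemma coe_exponents (d : ℕ →₀ ℕ) : (exponents d : Multiset ℕ+) = shape d := by
  unfold exponents shape
  rw [← Multiset.map_coe, Finset.sort_eq]

lemma shape_embDomain {ι κ : Type*} (f : ι ↪ κ) (d : ι →₀ ℕ) :
    shape (d.embDomain f) = shape d := by
  simp [shape, Finsupp.support_embDomain]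

lemma shape_add {ι : Type*} [DecidableEq ι] {d e : ι →₀ ℕ} (h : Disjoint d.support e.support) :
    shape (d + e) = shape d + shape e := by
  unfold shape
  rw [Finsupp.support_add_eq h, ← Finset.disjUnion_eq_union _ _ h, Finset.disjUnion_val,
    Multiset.map_add]
  congr 1
  · refine Multiset.map_congr rfl fun i hi => ?_
    have : e i = 0 := by
      simpa using Finset.disjoint_left.mp h (by simpa using hi)
    simp [this]
  · refine Multiset.map_congr rfl fun i hi => ?_
    have : d i = 0 := by
      simpa using Finset.disjoint_right.mp h (by simpa using hi)
    simp [this]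

lemma shape_zero {ι : Type*} : shape (0 : ι →₀ ℕ) = 0 := by simp [shape]

lemma shape_eq_zero {ι : Type*} {d : ι →₀ ℕ} : shape d = 0 ↔ d = 0 := by
  simp [shape]

lemma shape_sumElim {ι κ : Type*} (d : ι →₀ ℕ) (e : κ →₀ ℕ) :
    shape (d.sumElim e) = shape d + shape e := by
  classical
  have h : d.sumElim e = d.embDomain .inl + e.embDomain .inr := by
    rw [Finsupp.sumElim_eq_add, Finsupp.embDomain_eq_mapDomain, Finsupp.embDomain_eq_mapDomain]
    rfl
  rw [h, shape_add, shape_embDomain, shape_embDomain]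
  rw [Finsupp.support_embDomain, Finsupp.support_embDomain, Finset.disjoint_left]
  simp

/-- The sum of the parts of a partition. -/
def weight (p : Multiset ℕ+) : ℕ := (p.map PNat.val).sum

lemma weight_shape {ι : Type*} (d : ι →₀ ℕ) : weight (shape d) = d.degree := by
  have h : d.degree = (d.support.val.map fun i => d i).sum := rfl
  rw [h, weight, shape, Multiset.map_map]
  congr 1
  refine Multiset.map_congr rfl fun i hi => ?_
  have : d i ≠ 0 := Finsupp.mem_support_iff.mp hi
  exact PNat.toPNat'_coe (Nat.pos_of_ne_zero this)

lemma weight_add (p q : Multiset ℕ+) : weight (p + q) = weight p + weight q := by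
  simp [weight]

lemma exists_shape (p : Multiset ℕ+) : ∃ d : ℕ →₀ ℕ, shape d = p := by
  induction p using Multiset.induction_on with
  | empty => exact ⟨0, shape_zero⟩
  | cons a s ih =>
    obtain ⟨d, rfl⟩ := ih
    refine ⟨d.embDomain ⟨Nat.succ, Nat.succ_injective⟩ + Finsupp.single 0 (a : ℕ), ?_⟩
    rw [shape_add, shape_embDomain, add_comm, ← Multiset.singleton_add]
    · congr 1
      simp [shape]
    · rw [Finsupp.support_embDomain, Finset.disjoint_left]
      simp +contextual

lemma exists_perm_aux (s : Finset ℕ) : ∀ (t : Finset ℕ) (f g : ℕ → ℕ+),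
    s.val.map f = t.val.map g → ∃ σ : ℕ ≃ ℕ, s.map σ.toEmbedding = t ∧ ∀ i ∈ s, g (σ i) = f i := by
  classical
  induction s using Finset.induction_on with
  | empty =>
    intro t f g h
    refine ⟨Equiv.refl ℕ, ?_, by simp⟩
    have : t.val = 0 := by simpa using h.symm
    simpa using (Finset.val_eq_zero.mp this).symm
  | insert a s ha ih =>
    intro t f g h
    have hmem : f a ∈ t.val.map g := by rw [← h]; simp
    obtain ⟨b, hb, hgb⟩ := Multiset.mem_map.mp hmem
    have hb' : b ∈ t := hb
    have h' : s.val.map f = (t.erase b).val.map g := by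
      rw [← Finset.insert_erase hb', Finset.insert_val_of_notMem ha,
        Finset.insert_val_of_notMem (Finset.notMem_erase b t), Multiset.map_cons,
        Multiset.map_cons, hgb] at h
      exact (Multiset.cons_inj_right _).mp h
    obtain ⟨σ, hσ, hσ'⟩ := ih _ f g h'
    have hfix : ∀ i ∈ s, (Equiv.swap (σ a) b) (σ i) = σ i := by
      intro i hi
      apply Equiv.swap_apply_of_ne_of_ne
      · intro e
        exact ha (σ.injective e ▸ hi)
      · have : σ i ∈ t.erase b := by
          rw [← hσ]; exact Finset.mem_map_of_mem σ.toEmbedding hi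
        exact (Finset.mem_erase.mp this).1
    refine ⟨σ.trans (Equiv.swap (σ a) b), ?_, ?_⟩
    · rw [Finset.map_insert]
      conv_rhs => rw [← Finset.insert_erase hb', ← hσ]
      congr 1
      · simp
      · ext x
        simp only [Finset.mem_map, Equiv.coe_toEmbedding, Equiv.trans_apply]
        constructor
        · rintro ⟨i, hi, rfl⟩; exact ⟨i, hi, (hfix i hi).symm⟩
        · rintro ⟨i, hi, rfl⟩; exact ⟨i, hi, hfix i hi⟩
    · intro i hi
      rcases Finset.mem_insert.mp hi with rfl | hi
      · simp [hgb]
      · simp [hfix i hi, hσ' i hi]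

lemma exists_perm {d e : ℕ →₀ ℕ} (h : shape d = shape e) :
    ∃ σ : ℕ ≃ ℕ, d.embDomain σ.toEmbedding = e := by
  obtain ⟨σ, h1, h2⟩ := exists_perm_aux d.support e.support _ _ h
  refine ⟨σ, ?_⟩
  ext j
  obtain ⟨i, rfl⟩ := σ.surjective j
  have h3 := Finsupp.embDomain_apply_self σ.toEmbedding d i
  simp only [Equiv.coe_toEmbedding] at h3
  rw [h3]
  have hiff : i ∈ d.support ↔ σ i ∈ e.support := by
    rw [← h1]
    simp
  by_cases hi : i ∈ d.support
  · have := congrArg (fun a : ℕ+ => (a : ℕ)) (h2 i hi)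
    rw [PNat.toPNat'_coe (Nat.pos_of_ne_zero (Finsupp.mem_support_iff.mp (hiff.mp hi))),
      PNat.toPNat'_coe (Nat.pos_of_ne_zero (Finsupp.mem_support_iff.mp hi))] at this
    exact this.symm
  · rw [Finsupp.notMem_support_iff.mp hi, Finsupp.notMem_support_iff.mp (fun h => hi (hiff.mpr h))]

lemma finite_weight_le (N : ℕ) : {p : Multiset ℕ+ | weight p ≤ N}.Finite := by
  have h := (Set.finite_range fun x : (Σ n : Fin (N + 1), (n : ℕ).Partition) => x.2.parts).preimage
    (f := fun p : Multiset ℕ+ => p.map PNat.val)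
    (Multiset.map_injective PNat.coe_injective).injOn
  refine h.subset fun p hp => ?_
  refine ⟨⟨⟨weight p, Nat.lt_succ_of_le hp⟩, ⟨p.map PNat.val, ?_, rfl⟩⟩, rfl⟩
  intro i hi
  obtain ⟨a, -, rfl⟩ := Multiset.mem_map.mp hi
  exact a.pos

/-- All pairs of partitions `(q, r)` with `q ∪ r = p` (each pair once). -/
def splittings (p : Multiset ℕ+) : Finset (Multiset ℕ+ × Multiset ℕ+) :=
  p.antidiagonal.toFinset

lemma mem_splittings {p : Multiset ℕ+} {x : Multiset ℕ+ × Multiset ℕ+} :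
    x ∈ splittings p ↔ x.1 + x.2 = p := by
  simp [splittings]

end Shape

section PowerSeries

variable (k : Type u) [CommRing k]

/-- The algebra of formal power series of finite degree in the variables `x_0, x_1, x_2, …`. -/
def finiteDegree : Subalgebra k (MvPowerSeries ℕ k) where
  carrier := {f | ∃ N : ℕ, ∀ d : ℕ →₀ ℕ, N < d.degree → MvPowerSeries.coeff d f = 0}
  mul_mem' := by
    classical
    rintro f g ⟨M, hM⟩ ⟨N, hN⟩
    refine ⟨M + N, fun d hd => ?_⟩
    rw [MvPowerSeries.coeff_mul]
    refine Finset.sum_eq_zero fun p hp => ?_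
    rw [← Finset.HasAntidiagonal.mem_antidiagonal.mp hp, map_add] at hd
    by_cases h : M < p.1.degree
    · rw [hM _ h, zero_mul]
    · rw [hN p.2 (by omega), mul_zero]
  add_mem' := by
    rintro f g ⟨M, hM⟩ ⟨N, hN⟩
    exact ⟨M + N, fun d hd => by rw [map_add, hM d (by omega), hN d (by omega), add_zero]⟩
  algebraMap_mem' := by
    classical
    intro r
    refine ⟨0, fun d hd => ?_⟩
    rw [MvPowerSeries.algebraMap_apply, MvPowerSeries.coeff_C, if_neg]
    rintro rfl
    simp at hd

variable {k}

lemma finite_support_single (f : finiteDegree k) :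
    (Function.support fun n : ℕ => MvPowerSeries.coeff (Finsupp.single 0 n) f.1).Finite := by
  obtain ⟨N, hN⟩ := f.2
  refine (Set.finite_Iic N).subset fun n hn => ?_
  by_contra h
  exact hn (hN _ (by simpa using h))

lemma exists_firstVar (f : finiteDegree k) : ∃ P : Polynomial k,
    (∀ n, P.coeff n = MvPowerSeries.coeff (Finsupp.single 0 n) f.1) ∧
      P.eval 1 = ∑ᶠ n : ℕ, MvPowerSeries.coeff (Finsupp.single 0 n) f.1 := by
  obtain ⟨N, hN⟩ := f.2
  let P : Polynomial k := ∑ n ∈ Finset.range (N + 1),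
    Polynomial.monomial n (MvPowerSeries.coeff (Finsupp.single 0 n) f.1)
  have hP : ∀ n, P.coeff n = MvPowerSeries.coeff (Finsupp.single 0 n) f.1 := by
    intro n
    simp only [P, Polynomial.finsetSum_coeff, Polynomial.coeff_monomial]
    rw [Finset.sum_ite_eq']
    split_ifs with h
    · rfl
    · exact (hN _ (by simpa using h)).symm
  refine ⟨P, hP, ?_⟩
  rw [Polynomial.eval_eq_sum, Polynomial.sum_def, finsum_eq_sum_of_support_subset (s := P.support)]
  · exact Finset.sum_congr rfl fun n _ => by simp [hP]
  · intro n hn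
    simpa [hP] using hn

variable (k)

/-- The character `ζ_Q` on power series of finite degree: substitute `1` for the first variable
and `0` for all the other variables.  Only the monomials `x_0 ^ n` survive this substitution. -/
noncomputable def zetaQ : finiteDegree k →ₐ[k] k where
  toFun f := ∑ᶠ n : ℕ, MvPowerSeries.coeff (Finsupp.single 0 n) f.1
  map_zero' := by simp
  map_one' := by
    classical
    rw [finsum_eq_single _ 0]
    · simp
    · intro n hn
      simp [MvPowerSeries.coeff_one, hn]
  map_add' f g := by
    rw [← finsum_add_distrib (finite_support_single f) (finite_support_single g)]
    simp
  map_mul' f g := by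
    classical
    obtain ⟨P, hP, hP'⟩ := exists_firstVar f
    obtain ⟨Q, hQ, hQ'⟩ := exists_firstVar g
    obtain ⟨R, hR, hR'⟩ := exists_firstVar (f * g)
    rw [← hP', ← hQ', ← hR', ← Polynomial.eval_mul]
    congr 1
    ext n
    rw [Polynomial.coeff_mul, hR]
    change MvPowerSeries.coeff _ (f.1 * g.1) = _
    rw [MvPowerSeries.coeff_mul, Finsupp.antidiagonal_single, Finset.sum_map]
    exact Finset.sum_congr rfl fun x _ => by rw [hP, hQ]; rfl
  commutes' r := by
    classical
    rw [finsum_eq_single _ 0]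
    · simp [MvPowerSeries.algebraMap_apply]
    · intro n hn
      simp [MvPowerSeries.algebraMap_apply, MvPowerSeries.coeff_C, hn]

end PowerSeries

section Sym

variable (k : Type u) [CommRing k]

/-- The monomial quasi-symmetric function of a composition `α = (a_1, …, a_r)`: the sum of all
monomials `x_{i_1} ^ a_1 ⋯ x_{i_r} ^ a_r` with `i_1 < ⋯ < i_r`. -/
def monomialQSym (α : List ℕ+) : MvPowerSeries ℕ k :=
  fun d => if exponents d = α then 1 else 0

/-- The monomial symmetric function of a partition `p`: the sum of the monomial quasi-symmetric
functions of all the compositions that are rearrangements of `p`. -/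
def monomialSym (p : Multiset ℕ+) : MvPowerSeries ℕ k :=
  ∑ α ∈ p.lists.toFinset, monomialQSym k α

lemma coeff_monomialSym (p : Multiset ℕ+) (d : ℕ →₀ ℕ) :
    MvPowerSeries.coeff d (monomialSym k p) = if shape d = p then 1 else 0 := by
  rw [monomialSym, map_sum]
  simp only [MvPowerSeries.coeff_apply, monomialQSym]
  rw [Finset.sum_ite_eq]
  simp [Multiset.mem_lists_iff, coe_exponents, eq_comm]

/-- A symmetric power series: the coefficients depend only on the multiset of exponents. -/
def IsSymm {k : Type u} [CommRing k] (f : MvPowerSeries ℕ k) : Prop :=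
  ∀ d e : ℕ →₀ ℕ, shape d = shape e → MvPowerSeries.coeff d f = MvPowerSeries.coeff e f

variable {k}

lemma IsSymm.mul {f g : MvPowerSeries ℕ k} (hf : IsSymm f) (hg : IsSymm g) : IsSymm (f * g) := by
  classical
  intro d e h
  obtain ⟨σ, rfl⟩ := exists_perm h
  rw [MvPowerSeries.coeff_mul, MvPowerSeries.coeff_mul,
    ← Finsupp.image_prodMap_embDomain_antidiagonal, Finset.sum_image]
  · refine Finset.sum_congr rfl fun p _ => ?_
    rw [hf p.1 (p.1.embDomain σ.toEmbedding) (shape_embDomain _ _).symm,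
      hg p.2 (p.2.embDomain σ.toEmbedding) (shape_embDomain _ _).symm]
    rfl
  · exact ((Finsupp.embDomain_injective _).prodMap (Finsupp.embDomain_injective _)).injOn

lemma mem_span_monomialSym {f : MvPowerSeries ℕ k} :
    f ∈ Submodule.span k (Set.range (monomialSym k)) ↔ f ∈ finiteDegree k ∧ IsSymm f := by
  constructor
  · intro hf
    induction hf using Submodule.span_induction with
    | mem x hx =>
      obtain ⟨p, rfl⟩ := hx
      refine ⟨⟨weight p, fun d hd => ?_⟩, fun d e h => ?_⟩
      · rw [coeff_monomialSym, if_neg]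
        rintro rfl
        rw [weight_shape] at hd
        exact lt_irrefl _ hd
      · rw [coeff_monomialSym, coeff_monomialSym, h]
    | zero => exact ⟨zero_mem _, fun d e _ => by simp⟩
    | add x y _ _ hx hy =>
      exact ⟨add_mem hx.1 hy.1, fun d e h => by rw [map_add, map_add, hx.2 d e h, hy.2 d e h]⟩
    | smul a x _ hx =>
      exact ⟨Subalgebra.smul_mem _ hx.1 a, fun d e h => by
        rw [map_smul, map_smul, hx.2 d e h]⟩
  · rintro ⟨⟨N, hN⟩, hf⟩
    choose rep hrep using exists_shape
    have : f = ∑ p ∈ (finite_weight_le N).toFinset,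
        MvPowerSeries.coeff (rep p) f • monomialSym k p := by
      ext d
      rw [map_sum]
      simp only [map_smul, coeff_monomialSym, smul_eq_mul, mul_ite, mul_one, mul_zero]
      rw [Finset.sum_ite_eq]
      split_ifs with h
      · exact hf _ _ (hrep _).symm
      · apply hN
        rw [Set.Finite.mem_toFinset, Set.mem_ofPred_eq, weight_shape] at h
        omega
    rw [this]
    exact Submodule.sum_mem _ fun p _ => Submodule.smul_mem _ _
      (Submodule.subset_span (Set.mem_range_self p))

variable (k)

/-- The algebra `Sym` of symmetric functions: the span of the monomial symmetric functions. -/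
def Sym : Subalgebra k (MvPowerSeries ℕ k) where
  carrier := Submodule.span k (Set.range (monomialSym k))
  mul_mem' := by
    intro f g hf hg
    have hf' := mem_span_monomialSym.mp hf
    have hg' := mem_span_monomialSym.mp hg
    exact mem_span_monomialSym.mpr ⟨mul_mem hf'.1 hg'.1, hf'.2.mul hg'.2⟩
  add_mem' := fun hf hg => Submodule.add_mem _ hf hg
  algebraMap_mem' := by
    classical
    intro r
    refine mem_span_monomialSym.mpr ⟨Subalgebra.algebraMap_mem _ r, fun d e h => ?_⟩
    simp only [MvPowerSeries.algebraMap_apply, MvPowerSeries.coeff_C]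
    have : d = 0 ↔ e = 0 := by rw [← shape_eq_zero, h, shape_eq_zero]
    simp [this]

lemma Sym_le_finiteDegree : Sym k ≤ finiteDegree k :=
  fun _ hf => (mem_span_monomialSym.mp hf).1

lemma isSymm_of_mem (f : Sym k) : IsSymm f.1 := (mem_span_monomialSym.mp f.2).2

/-- The character `ζ_S` of `Sym`: the restriction of `ζ_Q`. -/
noncomputable def zetaS : Sym k →ₐ[k] k :=
  (zetaQ k).comp (Subalgebra.inclusion (Sym_le_finiteDegree k))

/-- The monomial symmetric functions, as elements of `Sym`. -/
def m (p : Multiset ℕ+) : Sym k :=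
  ⟨monomialSym k p, Submodule.subset_span (Set.mem_range_self p)⟩

lemma coeff_m (p : Multiset ℕ+) (d : ℕ →₀ ℕ) :
    MvPowerSeries.coeff d (m k p).1 = if shape d = p then 1 else 0 :=
  coeff_monomialSym k p d

lemma m_linearIndependent : LinearIndependent k (m k) := by
  rw [linearIndependent_iff']
  intro s g h p hp
  obtain ⟨d, rfl⟩ := exists_shape p
  have h2 := congrArg (fun f : Sym k => MvPowerSeries.coeff d f.1) h
  simpa [coeff_m, hp] using h2

lemma m_span : ⊤ ≤ Submodule.span k (Set.range (m k)) := by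
  rintro ⟨f, hf⟩ -
  have hf' : f ∈ Submodule.span k (Set.range (monomialSym k)) := hf
  have h : Set.range (monomialSym k) = (Sym k).val.toLinearMap '' Set.range (m k) := by
    rw [← Set.range_comp]; rfl
  rw [h, Submodule.span_image] at hf'
  obtain ⟨g, hg, hgf⟩ := hf'
  have : g = ⟨f, hf⟩ := Subtype.ext hgf
  exact this ▸ hg

/-- The linear basis of `Sym` given by the monomial symmetric functions. -/
noncomputable def mBasis : Module.Basis (Multiset ℕ+) k (Sym k) :=
  Module.Basis.mk (m_linearIndependent k) (m_span k)

@[simp] lemma mBasis_apply (p : Multiset ℕ+) : mBasis k p = m k p := by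
  simp [mBasis]

lemma mBasis_repr (f : Sym k) (d : ℕ →₀ ℕ) :
    (mBasis k).repr f (shape d) = MvPowerSeries.coeff d f.1 := by
  let A : Sym k →ₗ[k] k := Finsupp.lapply (shape d) ∘ₗ (mBasis k).repr.toLinearMap
  let B : Sym k →ₗ[k] k := MvPowerSeries.coeff d ∘ₗ (Sym k).val.toLinearMap
  have : A = B := by
    refine (mBasis k).ext fun p => ?_
    have : B (mBasis k p) = if shape d = p then 1 else 0 := by
      rw [mBasis_apply]; exact coeff_m k p d
    rw [this]
    simp [A, -mBasis_apply, Finsupp.single_apply, eq_comm]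
  exact congrArg (fun L : Sym k →ₗ[k] k => L f) this

/-- The homogeneous component of degree `n` of `Sym`. -/
noncomputable def symGrading (n : ℕ) : Submodule k (Sym k) :=
  Submodule.span k (m k '' {p | weight p = n})

end Sym

section Hopf

variable (k : Type u) [CommRing k]

/-- The comultiplication `Δ(m_p) = ∑ m_q ⊗ m_r`, over all pairs of partitions with `q ∪ r = p`.
This is the restriction to `Sym` of the deconcatenation coproduct of the monomial quasi-symmetric
functions. -/
noncomputable def symComul : Sym k →ₗ[k] Sym k ⊗[k] Sym k :=
  (mBasis k).constr k fun p => ∑ x ∈ splittings p, m k x.1 ⊗ₜ[k] m k x.2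

/-- The counit: the projection onto the component of degree zero. -/
noncomputable def symCounit : Sym k →ₗ[k] k :=
  (mBasis k).constr k fun p => if p = 0 then 1 else 0

lemma symComul_m (p : Multiset ℕ+) :
    symComul k (m k p) = ∑ x ∈ splittings p, m k x.1 ⊗ₜ[k] m k x.2 := by
  rw [← mBasis_apply, symComul, Module.Basis.constr_basis]

lemma symCounit_m (p : Multiset ℕ+) : symCounit k (m k p) = if p = 0 then 1 else 0 := by
  rw [← mBasis_apply, symCounit, Module.Basis.constr_basis]

lemma symCounit_apply (f : Sym k) : symCounit k f = MvPowerSeries.coeff 0 f.1 := by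
  have : symCounit k = MvPowerSeries.coeff 0 ∘ₗ (Sym k).val.toLinearMap := by
    refine (mBasis k).ext fun p => ?_
    have h : (MvPowerSeries.coeff 0 ∘ₗ (Sym k).val.toLinearMap) (m k p) =
      MvPowerSeries.coeff 0 (m k p).1 := rfl
    rw [mBasis_apply, symCounit_m, h, coeff_m, shape_zero]
    simp [eq_comm]
  exact congrArg (fun L : Sym k →ₗ[k] k => L f) this

lemma m_zero : m k 0 = 1 := by
  classical
  apply Subtype.ext
  ext d
  have h : MvPowerSeries.coeff d (1 : Sym k).1 = if d = 0 then 1 else 0 :=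
    MvPowerSeries.coeff_one (R := k) d
  rw [coeff_m, h]
  simp only [shape_eq_zero]

noncomputable instance : Coalgebra k (Sym k) where
  comul := symComul k
  counit := symCounit k
  coassoc := by
    refine (mBasis k).ext fun p => ?_
    simp only [mBasis_apply, LinearMap.comp_apply, symComul_m, map_sum, LinearMap.rTensor_tmul,
      LinearMap.lTensor_tmul, TensorProduct.sum_tmul, TensorProduct.tmul_sum,
      LinearEquiv.coe_coe, TensorProduct.assoc_tmul]
    rw [Finset.sum_sigma', Finset.sum_sigma']
    refine Finset.sum_bij' (fun x _ => ⟨(x.2.1, x.2.2 + x.1.2), (x.2.2, x.1.2)⟩)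
      (fun x _ => ⟨(x.1.1 + x.2.1, x.2.2), (x.1.1, x.2.1)⟩) ?_ ?_ ?_ ?_ ?_
    · rintro ⟨⟨a, b⟩, ⟨c, d⟩⟩ h
      simp only [Finset.mem_sigma, mem_splittings] at h ⊢
      exact ⟨by rw [← h.1, ← h.2, add_assoc], trivial⟩
    · rintro ⟨⟨a, b⟩, ⟨c, d⟩⟩ h
      simp only [Finset.mem_sigma, mem_splittings] at h ⊢
      exact ⟨by rw [← h.1, ← h.2, add_assoc], trivial⟩
    · rintro ⟨⟨a, b⟩, ⟨c, d⟩⟩ h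
      simp only [Finset.mem_sigma, mem_splittings] at h ⊢
      rw [h.2]
    · rintro ⟨⟨a, b⟩, ⟨c, d⟩⟩ h
      simp only [Finset.mem_sigma, mem_splittings] at h ⊢
      rw [h.2]
    · rintro ⟨⟨a, b⟩, ⟨c, d⟩⟩ h
      rfl
  rTensor_counit_comp_comul := by
    refine (mBasis k).ext fun p => ?_
    simp only [mBasis_apply, LinearMap.comp_apply, symComul_m, map_sum, LinearMap.rTensor_tmul,
      symCounit_m, TensorProduct.mk_apply]
    rw [Finset.sum_eq_single (0, p)]
    · simp
    · rintro ⟨a, b⟩ h hne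
      rw [mem_splittings] at h
      have : a ≠ 0 := by
        rintro rfl
        exact hne (by simpa using h)
      simp [this]
    · intro h
      exact absurd (mem_splittings.mpr (zero_add p)) h
  lTensor_counit_comp_comul := by
    refine (mBasis k).ext fun p => ?_
    simp only [mBasis_apply, LinearMap.comp_apply, symComul_m, map_sum, LinearMap.lTensor_tmul,
      symCounit_m, LinearMap.flip_apply, TensorProduct.mk_apply]
    rw [Finset.sum_eq_single (p, 0)]
    · simp
    · rintro ⟨a, b⟩ h hne
      rw [mem_splittings] at h
      have : b ≠ 0 := by
        rintro rfl
        exact hne (by simpa using h)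
      simp [this]
    · intro h
      exact absurd (mem_splittings.mpr (add_zero p)) h

/-- The coordinate of a tensor at `m_p ⊗ m_q`. -/
noncomputable def coord₂ (p q : Multiset ℕ+) : Sym k ⊗[k] Sym k →ₗ[k] k :=
  Finsupp.lapply (p, q) ∘ₗ ((mBasis k).tensorProduct (mBasis k)).repr.toLinearMap

lemma coord₂_tmul (p q : Multiset ℕ+) (f g : Sym k) :
    coord₂ k p q (f ⊗ₜ g) = (mBasis k).repr f p * (mBasis k).repr g q := by
  simp [coord₂, mul_comm]

variable {k}

lemma coord₂_ext {x y : Sym k ⊗[k] Sym k} (h : ∀ p q, coord₂ k p q x = coord₂ k p q y) :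
    x = y :=
  ((mBasis k).tensorProduct (mBasis k)).repr.injective (Finsupp.ext fun a => h a.1 a.2)

variable (k)

lemma coord₂_symComul (p q : Multiset ℕ+) (f : Sym k) :
    coord₂ k p q (symComul k f) = (mBasis k).repr f (p + q) := by
  have : coord₂ k p q ∘ₗ symComul k = Finsupp.lapply (p + q) ∘ₗ (mBasis k).repr.toLinearMap := by
    refine (mBasis k).ext fun r => ?_
    rw [LinearMap.comp_apply, mBasis_apply, symComul_m, map_sum]
    simp only [coord₂_tmul, ← mBasis_apply]
    simp only [Module.Basis.repr_self, LinearMap.comp_apply, Finsupp.lapply_apply,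
      LinearEquiv.coe_coe, Finsupp.single_apply]
    simp only [mul_ite, mul_one, mul_zero, ← ite_and]
    by_cases h : r = p + q
    · rw [Finset.sum_eq_single (p, q)]
      · simp [h]
      · rintro ⟨a, b⟩ - hne
        rw [if_neg]
        rintro ⟨rfl, rfl⟩
        exact hne rfl
      · intro h'
        exact absurd (mem_splittings.mpr h.symm) h'
    · rw [if_neg h]
      refine Finset.sum_eq_zero ?_
      rintro ⟨a, b⟩ hab
      rw [if_neg]
      rintro ⟨rfl, rfl⟩
      exact h (mem_splittings.mp hab).symm
  exact congrArg (fun L : Sym k →ₗ[k] k => L f) this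

open Finset.HasAntidiagonal in
lemma coord₂_mul (d e : ℕ →₀ ℕ) (x y : Sym k ⊗[k] Sym k) :
    coord₂ k (shape d) (shape e) (x * y) =
      ∑ a ∈ antidiagonal d, ∑ b ∈ antidiagonal e,
        coord₂ k (shape a.1) (shape b.1) x * coord₂ k (shape a.2) (shape b.2) y := by
  classical
  induction x with
  | zero => simp
  | add x x' hx hx' => simp only [add_mul, map_add, hx, hx', Finset.sum_add_distrib]
  | tmul f g =>
    induction y with
    | zero => simp
    | add y y' hy hy' => simp only [mul_add, map_add, hy, hy', Finset.sum_add_distrib]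
    | tmul f' g' =>
      rw [Algebra.TensorProduct.tmul_mul_tmul]
      simp only [coord₂_tmul, mBasis_repr]
      change MvPowerSeries.coeff d (f.1 * f'.1) * MvPowerSeries.coeff e (g.1 * g'.1) = _
      rw [MvPowerSeries.coeff_mul, MvPowerSeries.coeff_mul, Finset.sum_mul_sum]
      exact Finset.sum_congr rfl fun a _ => Finset.sum_congr rfl fun b _ => by ring

lemma symComul_mul (f g : Sym k) : symComul k (f * g) = symComul k f * symComul k g := by
  classical
  refine coord₂_ext fun p q => ?_
  obtain ⟨d, rfl⟩ := exists_shape p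
  obtain ⟨e, rfl⟩ := exists_shape q
  let σ : ℕ ⊕ ℕ ≃ ℕ := Equiv.natSumNatEquivNat
  have hs : ∀ d e : ℕ →₀ ℕ, shape ((d.sumElim e).embDomain σ.toEmbedding) = shape d + shape e :=
    fun d e => by rw [shape_embDomain, shape_sumElim]
  rw [coord₂_symComul, coord₂_mul]
  simp only [coord₂_symComul, ← hs, mBasis_repr]
  change MvPowerSeries.coeff _ (f.1 * g.1) = _
  rw [MvPowerSeries.coeff_mul, ← Finsupp.image_prodMap_embDomain_antidiagonal, Finset.sum_image,
    ← Finsupp.image_sumElim_product_antidiagonal, Finset.sum_image, Finset.sum_product]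
  · rfl
  · rintro ⟨⟨a, b⟩, ⟨c, d⟩⟩ - ⟨⟨a', b'⟩, ⟨c', d'⟩⟩ - h
    simp only [Prod.mk.injEq, DFunLike.ext_iff, Sum.forall, Finsupp.sumElim_inl,
      Finsupp.sumElim_inr] at h
    simp only [Prod.mk.injEq, DFunLike.ext_iff]
    tauto
  · exact ((Finsupp.embDomain_injective _).prodMap (Finsupp.embDomain_injective _)).injOn

lemma symComul_one : symComul k 1 = 1 := by
  have : splittings 0 = {(0, 0)} := by
    ext ⟨a, b⟩
    simp [mem_splittings]
  rw [← m_zero, symComul_m, this, Finset.sum_singleton, m_zero]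
  rfl

noncomputable instance : Bialgebra k (Sym k) :=
  Bialgebra.mk' k (Sym k)
    (by
      change symCounit k 1 = 1
      rw [← m_zero, symCounit_m, if_pos rfl])
    (by
      classical
      intro a b
      change symCounit k (a * b) = symCounit k a * symCounit k b
      simp only [symCounit_apply]
      change MvPowerSeries.coeff 0 (a.1 * b.1) = _
      simp [MvPowerSeries.coeff_mul])
    (symComul_one k) (symComul_mul k _ _)

/-- The antipode on the monomial basis, by recursion on the size of the partition. -/
noncomputable def antipodeM (p : Multiset ℕ+) : Sym k :=
  if p = 0 then 1 else
    -∑ x ∈ ((splittings p).filter fun x => x.1.card < p.card).attach,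
      antipodeM x.1.1 * m k x.1.2
termination_by p.card
decreasing_by exact (Finset.mem_filter.mp x.2).2

lemma sum_antipodeM (p : Multiset ℕ+) :
    ∑ x ∈ splittings p, antipodeM k x.1 * m k x.2 = if p = 0 then 1 else 0 := by
  by_cases hp : p = 0
  · subst hp
    have : splittings 0 = {(0, 0)} := by
      ext ⟨a, b⟩
      simp [mem_splittings]
    rw [this, Finset.sum_singleton, m_zero, antipodeM]
    simp
  · rw [if_neg hp, ← Finset.sum_filter_add_sum_filter_not _ (fun x => x.1.card < p.card)]
    have : (splittings p).filter (fun x => ¬ x.1.card < p.card) = {(p, 0)} := by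
      ext ⟨a, b⟩
      simp only [Finset.mem_filter, mem_splittings, Finset.mem_singleton, Prod.mk.injEq]
      constructor
      · rintro ⟨rfl, h⟩
        simp at h
        simp [h]
      · rintro ⟨rfl, rfl⟩
        simp
    rw [this, Finset.sum_singleton, m_zero, mul_one]
    conv_lhs => rw [antipodeM.eq_def k p]
    rw [if_neg hp, Finset.sum_attach _
      (fun x : Multiset ℕ+ × Multiset ℕ+ => antipodeM k x.1 * m k x.2)]
    exact add_neg_cancel _

noncomputable instance : HopfAlgebra k (Sym k) where
  antipode := (mBasis k).constr k (antipodeM k)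
  mul_antipode_rTensor_comul := by
    refine (mBasis k).ext fun p => ?_
    have hc : Coalgebra.comul (R := k) (m k p) = _ := symComul_m k p
    have he : Coalgebra.counit (R := k) (m k p) = _ := symCounit_m k p
    simp only [mBasis_apply, LinearMap.comp_apply, hc, he, map_sum, LinearMap.rTensor_tmul,
      LinearMap.mul'_apply]
    simp only [← mBasis_apply, Module.Basis.constr_basis]
    simp only [mBasis_apply, sum_antipodeM]
    split_ifs <;> simp
  mul_antipode_lTensor_comul := by
    refine (mBasis k).ext fun p => ?_
    have hc : Coalgebra.comul (R := k) (m k p) = _ := symComul_m k p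
    have he : Coalgebra.counit (R := k) (m k p) = _ := symCounit_m k p
    simp only [mBasis_apply, LinearMap.comp_apply, hc, he, map_sum, LinearMap.lTensor_tmul,
      LinearMap.mul'_apply]
    simp only [← mBasis_apply, Module.Basis.constr_basis]
    simp only [mBasis_apply]
    have : ∑ x ∈ splittings p, m k x.1 * antipodeM k x.2 =
        ∑ x ∈ splittings p, antipodeM k x.1 * m k x.2 := by
      refine Finset.sum_bij' (fun x _ => x.swap) (fun x _ => x.swap) ?_ ?_ ?_ ?_ ?_
      · intro x hx
        rw [mem_splittings] at hx ⊢
        rw [← hx, add_comm]; rfl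
      · intro x hx
        rw [mem_splittings] at hx ⊢
        rw [← hx, add_comm]; rfl
      · intro x _; rfl
      · intro x _; rfl
      · intro x _; exact mul_comm _ _
    rw [this, sum_antipodeM]
    split_ifs <;> simp

end Hopf

section Combinatorial

variable (k : Type u) [CommRing k]

/-- A graded coalgebra: the comultiplication and the counit preserve the grading
(`k` being concentrated in degree `0`). -/
structure IsGradedCoalgebra {C : Type v} [AddCommGroup C] [Module k C] [Coalgebra k C]
    (𝒞 : ℕ → Submodule k C) : Prop where
  isInternal : DirectSum.IsInternal 𝒞
  comul_mem : ∀ n, ∀ c ∈ 𝒞 n, Coalgebra.comul (R := k) c ∈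
    ⨆ p ∈ Finset.HasAntidiagonal.antidiagonal n,
      LinearMap.range (TensorProduct.map (𝒞 p.1).subtype (𝒞 p.2).subtype)
  counit_eq_zero : ∀ n ≠ 0, ∀ c ∈ 𝒞 n, Coalgebra.counit (R := k) c = 0

/-- A combinatorial coalgebra: a graded connected coalgebra with finite homogeneous components and
a linear functional `ζ` which is normalized, that is, agrees with the counit in degree `0`. -/
structure IsCombinatorialCoalgebra {C : Type v} [AddCommGroup C] [Module k C] [Coalgebra k C]
    (𝒞 : ℕ → Submodule k C) (ζ : C →ₗ[k] k) : Prop extends IsGradedCoalgebra k 𝒞 where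
  connected : Function.Bijective ((Coalgebra.counit (R := k) (A := C)).domRestrict (𝒞 0))
  finite : ∀ n, Module.Finite k (𝒞 n)
  zeta_eq_counit : ∀ c ∈ 𝒞 0, ζ c = Coalgebra.counit (R := k) c

/-- A graded connected Hopf algebra with finite homogeneous components: all the structure maps
preserve the grading, and the component of degree `0` is `k · 1`.  Together with a character
`ζ : H →ₐ[k] k` it is a combinatorial Hopf algebra. -/
structure IsGradedConnectedHopfAlgebra {H : Type v} [Ring H] [HopfAlgebra k H]
    (ℋ : ℕ → Submodule k H) : Prop extends IsGradedCoalgebra k ℋ where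
  one_mem : (1 : H) ∈ ℋ 0
  mul_mem : ∀ i j, ∀ a ∈ ℋ i, ∀ b ∈ ℋ j, a * b ∈ ℋ (i + j)
  antipode_mem : ∀ n, ∀ a ∈ ℋ n, HopfAlgebra.antipode k a ∈ ℋ n
  connected : ℋ 0 = Submodule.span k {1}
  finite : ∀ n, Module.Finite k (ℋ n)

/-- The linear map `Ψ` preserves the gradings and the functionals. -/
structure PreservesGradingAndZeta {C : Type v} [AddCommGroup C] [Module k C]
    (𝒞 : ℕ → Submodule k C) (ζ : C →ₗ[k] k) {D : Type*} [AddCommGroup D] [Module k D]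
    (𝒟 : ℕ → Submodule k D) (η : D →ₗ[k] k) (Ψ : C →ₗ[k] D) : Prop where
  map_mem : ∀ n, ∀ c ∈ 𝒞 n, Ψ c ∈ 𝒟 n
  zeta_comp : η ∘ₗ Ψ = ζ

end Combinatorial

end SymFun

namespace SymFun

/-! ### The grading of `Sym` by weight, and its compatibility with the Hopf structure. -/

section Grading

variable {k : Type u} [CommRing k]

/-! A linear map `Ψ : C → Sym` amounts to its coordinates `ψ_p` in the basis `m_p`, and it preserves
degrees exactly when each `ψ_p` vanishes outside degree `weight p`. Because `Δ m_p` is the sum of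
all `m_q ⊗ m_r` with `q + r = p`, the map is comultiplicative if and only if `ψ_{p+q}` is the
convolution product of `ψ_p` and `ψ_q` (`map_comp_comul_iff`), and counital if and only if `ψ_0` is
the counit. So a coalgebra morphism is a monoid homomorphism from partitions under union, the free
commutative monoid on `ℕ+`, to the convolution algebra of functionals, and it is determined by the
`ψ_{a}` with one part.

On `Sym_n` the character `ζ_S` reads off the coordinate at the partition with single part `n`
(`zetaS_apply`), so `ζ_S ∘ Ψ = ζ` forces `ψ_{a}` to be the degree `a` component of `ζ`. This gives
uniqueness (`coalgHom_ext`), for which `C` need not be cocommutative. For existence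
(`exists_coalgHom`), `ψ_p` is the convolution product of these components over the parts of `p`;
cocommutativity makes convolution commutative, so the order of the parts is irrelevant.

For a Hopf algebra `H`, multiplicativity of `Ψ` follows from uniqueness on `H ⊗ H`: both `x ⊗ y ↦ Ψ
(x y)` and `x ⊗ y ↦ Ψ x Ψ y` are graded coalgebra morphisms to `Sym` with the same composite with
`ζ_S` (`map_mul_of_preserves`). -/

lemma weight_eq_zero {p : Multiset ℕ+} : weight p = 0 ↔ p = 0 := by
  obtain ⟨d, rfl⟩ := exists_shape p
  rw [weight_shape, shape_eq_zero, Finsupp.degree_eq_zero_iff]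

lemma finite_weight_eq (n : ℕ) : {p : Multiset ℕ+ | weight p = n}.Finite :=
  (finite_weight_le n).subset fun _ h => le_of_eq h

lemma m_mem_symGrading (p : Multiset ℕ+) : m k p ∈ symGrading k (weight p) :=
  Submodule.subset_span ⟨p, rfl, rfl⟩

lemma mem_symGrading {n : ℕ} {f : Sym k} :
    f ∈ symGrading k n ↔ ∀ p, weight p ≠ n → (mBasis k).repr f p = 0 := by
  have h : symGrading k n = Submodule.span k (mBasis k '' {p | weight p = n}) := by
    simp [symGrading]
  rw [h, Module.Basis.mem_span_image]
  constructor
  · intro hf p hp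
    by_contra h0
    exact hp (hf (Finsupp.mem_support_iff.mpr h0))
  · intro hf p hp
    by_contra h0
    exact Finsupp.mem_support_iff.mp hp (hf p h0)

lemma symGrading_zero : symGrading k 0 = Submodule.span k {1} := by
  have : {p : Multiset ℕ+ | weight p = 0} = {0} := by
    ext p
    exact weight_eq_zero
  rw [symGrading, this, Set.image_singleton, m_zero]

/-- The coordinate at `shape d` is the coefficient of `x ^ d`, and when `d` has degree other than `i
+ j`, every splitting of `d` gives one factor a monomial of the wrong degree. -/
lemma symGrading_mul_mem {i j : ℕ} {f g : Sym k} (hf : f ∈ symGrading k i)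
    (hg : g ∈ symGrading k j) : f * g ∈ symGrading k (i + j) := by
  classical
  rw [mem_symGrading] at *
  intro p hp
  obtain ⟨d, rfl⟩ := exists_shape p
  rw [mBasis_repr]
  change MvPowerSeries.coeff d (f.1 * g.1) = 0
  rw [MvPowerSeries.coeff_mul]
  refine Finset.sum_eq_zero fun x hx => ?_
  rw [weight_shape, ← Finset.HasAntidiagonal.mem_antidiagonal.mp hx, map_add] at hp
  by_cases h : x.1.degree = i
  · rw [← mBasis_repr k g, hg _ (by rw [weight_shape]; omega), mul_zero]
  · rw [← mBasis_repr k f, hf _ (by rwa [weight_shape]), zero_mul]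

lemma iSup_symGrading : iSup (symGrading k) = ⊤ := by
  rw [eq_top_iff]
  refine (m_span k).trans (Submodule.span_le.mpr ?_)
  rintro _ ⟨p, rfl⟩
  exact Submodule.mem_iSup_of_mem (weight p) (m_mem_symGrading p)

/-- The weight cuts the monomial basis into disjoint blocks, and disjoint parts of a basis span
disjoint submodules. -/
lemma isInternal_symGrading : DirectSum.IsInternal (symGrading k) := by
  refine DirectSum.isInternal_submodule_of_iSupIndep_of_iSup_eq_top ?_ iSup_symGrading
  intro n
  have h : Disjoint {p : Multiset ℕ+ | weight p = n} {p | weight p ≠ n} :=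
    Set.disjoint_left.mpr fun p hp hp' => hp' hp
  refine ((m_linearIndependent k).disjoint_span_image h).mono_right ?_
  refine iSup₂_le fun j hj => Submodule.span_mono (Set.image_mono fun p hp => ?_)
  rw [Set.mem_ofPred_eq] at hp ⊢
  rwa [hp]

/-- The component of degree `n` of the tensor product of two families of submodules. -/
def tensorGrading {C : Type*} [AddCommGroup C] [Module k C] (𝒞 : ℕ → Submodule k C) (n : ℕ) :
    Submodule k (C ⊗[k] C) :=
  ⨆ p ∈ Finset.HasAntidiagonal.antidiagonal n,
    LinearMap.range (TensorProduct.map (𝒞 p.1).subtype (𝒞 p.2).subtype)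

lemma tmul_mem_tensorGrading {C : Type*} [AddCommGroup C] [Module k C] {𝒞 : ℕ → Submodule k C}
    {i j : ℕ} {x y : C} (hx : x ∈ 𝒞 i) (hy : y ∈ 𝒞 j) :
    x ⊗ₜ[k] y ∈ tensorGrading 𝒞 (i + j) := by
  refine Submodule.mem_iSup_of_mem (i, j) (Submodule.mem_iSup_of_mem ?_ ?_)
  · simp
  · exact ⟨(⟨x, hx⟩ : 𝒞 i) ⊗ₜ (⟨y, hy⟩ : 𝒞 j), rfl⟩

/-- Reduces statements about a tensor component to pure tensors of homogeneous elements. -/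
lemma tensorGrading_le {C : Type*} [AddCommGroup C] [Module k C] {𝒞 : ℕ → Submodule k C} {n : ℕ}
    {S : Submodule k (C ⊗[k] C)}
    (h : ∀ i j, i + j = n → ∀ x ∈ 𝒞 i, ∀ y ∈ 𝒞 j, x ⊗ₜ[k] y ∈ S) : tensorGrading 𝒞 n ≤ S := by
  refine iSup₂_le fun p hp => ?_
  rintro _ ⟨z, rfl⟩
  induction z with
  | zero => simp
  | add z w hz hw => rw [map_add]; exact add_mem hz hw
  | tmul x y => exact h _ _ (Finset.HasAntidiagonal.mem_antidiagonal.mp hp) _ x.2 _ y.2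

/-- Exhaustion is all that `coalgHom_ext` asks of a grading, so independence of the tensor
components is never needed. -/
lemma iSup_tensorGrading {C : Type*} [AddCommGroup C] [Module k C] {𝒞 : ℕ → Submodule k C}
    (h : iSup 𝒞 = ⊤) : iSup (tensorGrading 𝒞) = ⊤ := by
  rw [eq_top_iff]
  rintro z -
  induction z with
  | zero => exact zero_mem _
  | add z w hz hw => exact add_mem hz hw
  | tmul x y =>
    have hx : x ∈ iSup 𝒞 := h ▸ Submodule.mem_top
    have hy : y ∈ iSup 𝒞 := h ▸ Submodule.mem_top
    refine Submodule.iSup_induction 𝒞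
      (motive := fun x => x ⊗ₜ[k] y ∈ iSup (tensorGrading 𝒞)) hx (fun i x hx => ?_) (by simp)
      fun x x' hx hx' => by rw [TensorProduct.add_tmul]; exact add_mem hx hx'
    exact Submodule.iSup_induction 𝒞
      (motive := fun y => x ⊗ₜ[k] y ∈ iSup (tensorGrading 𝒞)) hy
      (fun j y hy => Submodule.mem_iSup_of_mem (i + j) (tmul_mem_tensorGrading hx hy)) (by simp)
      fun y y' hy hy' => by rw [TensorProduct.tmul_add]; exact add_mem hy hy'

lemma comul_m (p : Multiset ℕ+) : Coalgebra.comul (R := k) (m k p) =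
    ∑ x ∈ splittings p, m k x.1 ⊗ₜ[k] m k x.2 := symComul_m k p

lemma counit_m (p : Multiset ℕ+) : Coalgebra.counit (R := k) (m k p) = if p = 0 then 1 else 0 :=
  symCounit_m k p

lemma symComul_mem {n : ℕ} {f : Sym k} (hf : f ∈ symGrading k n) :
    Coalgebra.comul (R := k) f ∈ tensorGrading (symGrading k) n := by
  have : symGrading k n ≤ (tensorGrading (symGrading k) n).comap Coalgebra.comul := by
    refine Submodule.span_le.mpr ?_
    rintro _ ⟨p, rfl, rfl⟩
    rw [SetLike.mem_coe, Submodule.mem_comap, comul_m]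
    refine Submodule.sum_mem _ fun x hx => ?_
    rw [← mem_splittings.mp hx, weight_add]
    exact tmul_mem_tensorGrading (m_mem_symGrading _) (m_mem_symGrading _)
  exact this hf

lemma symCounit_eq_zero {n : ℕ} (hn : n ≠ 0) {f : Sym k} (hf : f ∈ symGrading k n) :
    Coalgebra.counit (R := k) f = 0 := by
  have : symGrading k n ≤ LinearMap.ker (Coalgebra.counit (R := k) (A := Sym k)) := by
    refine Submodule.span_le.mpr ?_
    rintro _ ⟨p, rfl, rfl⟩
    rw [SetLike.mem_coe, LinearMap.mem_ker, counit_m, if_neg (mt weight_eq_zero.mpr hn)]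
  exact this hf

/-- The induction on the number of parts follows the recursion defining `antipodeM`; weights add up
over each splitting. -/
lemma antipodeM_mem (p : Multiset ℕ+) : antipodeM k p ∈ symGrading k (weight p) := by
  induction h : p.card using Nat.strong_induction_on generalizing p with
  | _ n ih =>
    rw [antipodeM]
    split_ifs with hp
    · rw [hp, weight_eq_zero.mpr rfl, symGrading_zero]
      exact Submodule.mem_span_singleton_self 1
    · refine neg_mem (Submodule.sum_mem _ fun x _ => ?_)
      have hx := Finset.mem_filter.mp x.2
      have hmem := symGrading_mul_mem (ih _ (h ▸ hx.2) x.1.1 rfl) (m_mem_symGrading (k := k) x.1.2)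
      rwa [← weight_add, mem_splittings.mp hx.1] at hmem

lemma symAntipode_mem {n : ℕ} {f : Sym k} (hf : f ∈ symGrading k n) :
    HopfAlgebra.antipode k f ∈ symGrading k n := by
  have : symGrading k n ≤ (symGrading k n).comap (HopfAlgebra.antipode k (A := Sym k)) := by
    refine Submodule.span_le.mpr ?_
    rintro _ ⟨p, rfl, rfl⟩
    rw [SetLike.mem_coe, Submodule.mem_comap]
    have : HopfAlgebra.antipode k (m k p) = antipodeM k p := by
      rw [← mBasis_apply]
      exact (mBasis k).constr_basis k (antipodeM k) p
    rw [this]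
    exact antipodeM_mem p
  exact this hf

lemma isCocomm_sym : Coalgebra.IsCocomm k (Sym k) where
  comm_comp_comul := by
    refine (mBasis k).ext fun p => ?_
    simp only [LinearMap.comp_apply, mBasis_apply, comul_m, map_sum, LinearEquiv.coe_coe,
      TensorProduct.comm_tmul]
    refine Finset.sum_nbij' Prod.swap Prod.swap ?_ ?_ ?_ ?_ ?_
    · intro x hx
      rw [mem_splittings] at hx ⊢
      rw [← hx, add_comm]; rfl
    · intro x hx
      rw [mem_splittings] at hx ⊢
      rw [← hx, add_comm]; rfl
    · intro x _; rfl
    · intro x _; rfl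
    · intro x _; rfl

variable (k) in
lemma isGradedConnectedHopfAlgebra_sym :
    IsGradedConnectedHopfAlgebra k (symGrading k) where
  isInternal := isInternal_symGrading
  comul_mem _ _ := symComul_mem
  counit_eq_zero _ hn _ := symCounit_eq_zero hn
  one_mem := by rw [symGrading_zero]; exact Submodule.mem_span_singleton_self 1
  mul_mem _ _ _ ha _ hb := symGrading_mul_mem ha hb
  antipode_mem _ _ := symAntipode_mem
  connected := symGrading_zero
  finite n := Module.Finite.span_of_finite k ((finite_weight_eq n).image _)

/-- In degree `0` every element is `r • 1`, and both the counit and the character send it to `r`.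
This makes the counit bijective there and `ζ` normalized. -/
lemma IsGradedConnectedHopfAlgebra.isCombinatorialCoalgebra {H : Type v} [Ring H]
    [HopfAlgebra k H] {ℋ : ℕ → Submodule k H} (h : IsGradedConnectedHopfAlgebra k ℋ)
    (ζ : H →ₐ[k] k) : IsCombinatorialCoalgebra k ℋ ζ.toLinearMap where
  toIsGradedCoalgebra := h.toIsGradedCoalgebra
  finite := h.finite
  connected := by
    constructor
    · rw [← LinearMap.ker_eq_bot, LinearMap.ker_eq_bot']
      rintro ⟨c, hc⟩ h0
      have hc' := hc
      rw [h.connected, Submodule.mem_span_singleton] at hc'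
      obtain ⟨r, rfl⟩ := hc'
      have : r = 0 := by simpa using h0
      simp [this]
    · intro r
      exact ⟨⟨r • 1, Submodule.smul_mem _ r h.one_mem⟩, by simp⟩
  zeta_eq_counit c hc := by
    rw [h.connected, Submodule.mem_span_singleton] at hc
    obtain ⟨r, rfl⟩ := hc
    simp

lemma weight_shape_single (n : ℕ) : weight (shape (Finsupp.single (0 : ℕ) n)) = n := by
  simp [weight_shape]

lemma shape_single_pnat (a : ℕ+) : shape (Finsupp.single (0 : ℕ) (a : ℕ)) = {a} := by
  simp [shape]

/-- On `Sym_n` the character `ζ_S` is the coordinate at the partition with the single part `n`. -/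
lemma zetaS_apply {n : ℕ} {f : Sym k} (hf : f ∈ symGrading k n) :
    zetaS k f = (mBasis k).repr f (shape (Finsupp.single (0 : ℕ) n)) := by
  have h : zetaS k f = ∑ᶠ i : ℕ, MvPowerSeries.coeff (Finsupp.single 0 i) f.1 := rfl
  -- A homogeneous `f` of degree `n` contains no power of the first variable except the `n`-th.
  rw [h, finsum_eq_single _ n, mBasis_repr]
  intro i hi
  rw [← mBasis_repr]
  exact mem_symGrading.mp hf _ (by rwa [weight_shape_single])

end Grading

/-! ### Coordinates of maps to `Sym`, convolution, and uniqueness. -/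

section Coordinates

open WithConv

variable {k : Type u} [CommRing k]

/-- The coordinate at `m_p` of a linear map to `Sym`, as an element of the convolution algebra. -/
noncomputable def coordinate {C : Type*} [AddCommGroup C] [Module k C] (Ψ : C →ₗ[k] Sym k)
    (p : Multiset ℕ+) : WithConv (C →ₗ[k] k) :=
  toConv (Finsupp.lapply p ∘ₗ (mBasis k).repr.toLinearMap ∘ₗ Ψ)

lemma coordinate_apply {C : Type*} [AddCommGroup C] [Module k C] (Ψ : C →ₗ[k] Sym k)
    (p : Multiset ℕ+) (c : C) : coordinate Ψ p c = (mBasis k).repr (Ψ c) p := rfl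

/-- At `z = Δ c` the right-hand side is the convolution product of the two coordinates, evaluated at
`c`. -/
lemma coord₂_map {C : Type*} [AddCommGroup C] [Module k C] (Ψ : C →ₗ[k] Sym k)
    (p q : Multiset ℕ+) (z : C ⊗[k] C) : coord₂ k p q (TensorProduct.map Ψ Ψ z) =
      LinearMap.mul' k k
        (TensorProduct.map (coordinate Ψ p).ofConv (coordinate Ψ q).ofConv z) := by
  induction z with
  | zero => simp
  | add z w hz hw => simp only [map_add, hz, hw]
  | tmul x y =>
    rw [TensorProduct.map_tmul, coord₂_tmul, TensorProduct.map_tmul, LinearMap.mul'_apply]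
    rfl

/-- A linear map to `Sym` is comultiplicative if and only if its coordinates are multiplicative
for the convolution. -/
lemma map_comp_comul_iff {C : Type*} [AddCommGroup C] [Module k C] [Coalgebra k C]
    (Ψ : C →ₗ[k] Sym k) :
    TensorProduct.map Ψ Ψ ∘ₗ Coalgebra.comul = Coalgebra.comul ∘ₗ Ψ ↔
      ∀ p q, coordinate Ψ (p + q) = coordinate Ψ p * coordinate Ψ q := by
  -- The only basis element whose coproduct involves `m_p ⊗ m_q` is `m_{p+q}`.
  have key : ∀ p q c, coord₂ k p q (Coalgebra.comul (R := k) (Ψ c)) = coordinate Ψ (p + q) c :=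
    fun p q c => coord₂_symComul k p q (Ψ c)
  constructor
  · intro h p q
    ext c
    rw [LinearMap.convMul_apply, ← coord₂_map, ← key]
    exact congrArg _ (LinearMap.congr_fun h c).symm
  · intro h
    ext c
    refine coord₂_ext fun p q => ?_
    rw [LinearMap.comp_apply, LinearMap.comp_apply, key, coord₂_map, h, LinearMap.convMul_apply]

/-- The coordinate at the empty partition is the composition with the counit. -/
lemma coordinate_zero {C : Type*} [AddCommGroup C] [Module k C] (Ψ : C →ₗ[k] Sym k) (c : C) :
    coordinate Ψ 0 c = Coalgebra.counit (R := k) (Ψ c) := by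
  have h : Coalgebra.counit (R := k) (Ψ c) = MvPowerSeries.coeff 0 (Ψ c).1 :=
    symCounit_apply k (Ψ c)
  rw [h, coordinate_apply, ← mBasis_repr, shape_zero]

/-- A morphism of coalgebras to `Sym` that preserves the degree is determined by its composition
with `ζ_S`. -/
lemma coalgHom_ext {D : Type*} [AddCommGroup D] [Module k D] [Coalgebra k D]
    {𝒟 : ℕ → Submodule k D} (h𝒟 : iSup 𝒟 = ⊤) {Ψ Φ : D →ₗc[k] Sym k}
    (hΨ : ∀ n, ∀ c ∈ 𝒟 n, Ψ c ∈ symGrading k n) (hΦ : ∀ n, ∀ c ∈ 𝒟 n, Φ c ∈ symGrading k n)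
    (hζ : ∀ n, ∀ c ∈ 𝒟 n, zetaS k (Ψ c) = zetaS k (Φ c)) : Ψ = Φ := by
  have h1 : ∀ a : ℕ+, coordinate Ψ.toLinearMap {a} = coordinate Φ.toLinearMap {a} := by
    intro a
    ext c
    have hc : c ∈ iSup 𝒟 := h𝒟 ▸ Submodule.mem_top
    refine Submodule.iSup_induction 𝒟 (motive := fun c => coordinate Ψ.toLinearMap {a} c =
      coordinate Φ.toLinearMap {a} c) hc (fun n c hc => ?_) ?_ fun x y hx hy => ?_
    · change (mBasis k).repr (Ψ c) {a} = (mBasis k).repr (Φ c) {a}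
      -- In degree `a` this coordinate is the value of `ζ_S`; in all other degrees it vanishes for
      -- both maps.
      by_cases hn : n = a
      · have := hζ n c hc
        rwa [zetaS_apply (hΨ n c hc), zetaS_apply (hΦ n c hc), hn, shape_single_pnat] at this
      · have hw : weight {a} ≠ n := by simpa [weight] using Ne.symm hn
        rw [mem_symGrading.mp (hΨ n c hc) _ hw, mem_symGrading.mp (hΦ n c hc) _ hw]
    · simp [coordinate_apply]
    · simp only [coordinate_apply, map_add] at hx hy ⊢
      rw [hx, hy]
  have h2 : ∀ p, coordinate Ψ.toLinearMap p = coordinate Φ.toLinearMap p := by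
    intro p
    induction p using Multiset.induction_on with
    | empty =>
      ext c
      have hl := coordinate_zero Ψ.toLinearMap c
      have hr := coordinate_zero Φ.toLinearMap c
      have hΨc : Coalgebra.counit (R := k) (Ψ c) = Coalgebra.counit c :=
        CoalgHomClass.counit_comp_apply Ψ c
      have hΦc : Coalgebra.counit (R := k) (Φ c) = Coalgebra.counit c :=
        CoalgHomClass.counit_comp_apply Φ c
      exact hl.trans (hΨc.trans (hΦc.symm.trans hr.symm))
    | cons a s ih =>
      -- Convolution multiplicativity splits off one part at a time.
      rw [← Multiset.singleton_add, (map_comp_comul_iff _).mp Ψ.map_comp_comul,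
        (map_comp_comul_iff _).mp Φ.map_comp_comul, h1, ih]
  ext1 c
  refine (mBasis k).repr.injective (Finsupp.ext fun p => ?_)
  exact congrArg (fun F : WithConv (D →ₗ[k] k) => F c) (h2 p)

end Coordinates

/-! ### Construction of the morphism from a cocommutative combinatorial coalgebra. -/

section Existence

open WithConv

variable {k : Type u} [CommRing k] {C : Type v} [AddCommGroup C] [Module k C]

/-- The linear functional that agrees with `ζ` in degree `n` and vanishes in other degrees. -/
lemma exists_homogeneous_component {𝒞 : ℕ → Submodule k C} (h : DirectSum.IsInternal 𝒞)
    (ζ : C →ₗ[k] k) (n : ℕ) :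
    ∃ f : C →ₗ[k] k, ∀ i, ∀ c ∈ 𝒞 i, f c = if i = n then ζ c else 0 := by
  let e : DirectSum ℕ (fun i => 𝒞 i) ≃ₗ[k] C :=
    LinearEquiv.ofBijective (DirectSum.coeLinearMap 𝒞) h
  refine ⟨DirectSum.toModule k ℕ k (fun i => if i = n then ζ ∘ₗ (𝒞 i).subtype else 0) ∘ₗ
    e.symm.toLinearMap, fun i c hc => ?_⟩
  have he : e.symm c = DirectSum.lof k ℕ (fun i => 𝒞 i) i ⟨c, hc⟩ := by
    rw [LinearEquiv.symm_apply_eq]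
    exact (DirectSum.coeLinearMap_lof 𝒞 i ⟨c, hc⟩).symm
  rw [LinearMap.comp_apply, LinearEquiv.coe_coe, he, DirectSum.toModule_lof]
  split_ifs <;> rfl

/-- A family of functionals indexed by partitions, the one at `p` concentrated in degree
`weight p`, is the family of coordinates of a linear map to `Sym`. -/
lemma exists_coordinate_eq {𝒞 : ℕ → Submodule k C} (h : iSup 𝒞 = ⊤)
    (F : Multiset ℕ+ → WithConv (C →ₗ[k] k))
    (hF : ∀ p, ∀ n ≠ weight p, ∀ c ∈ 𝒞 n, F p c = 0) :
    ∃ Ψ : C →ₗ[k] Sym k, ∀ p, coordinate Ψ p = F p := by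
  -- A homogeneous `c` of degree `n` is seen only by the finitely many partitions of weight `n`, and
  -- every element is a finite sum of homogeneous ones.
  have hfin : ∀ c, (Function.support fun p => (F p).ofConv c).Finite := by
    intro c
    have hc : c ∈ iSup 𝒞 := h ▸ Submodule.mem_top
    refine Submodule.iSup_induction 𝒞
      (motive := fun c => (Function.support fun p => (F p).ofConv c).Finite) hc
      (fun n c hc => ?_) (by simp) fun x y hx hy => ?_
    · refine (finite_weight_eq n).subset fun p hp => ?_
      by_contra hne
      exact hp (hF p n (Ne.symm hne) c hc)
    · refine (hx.union hy).subset ?_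
      simp only [map_add]
      exact Function.support_add _ _
  let L : C →ₗ[k] (Multiset ℕ+ →₀ k) :=
    { toFun := fun c => Finsupp.ofSupportFinite _ (hfin c)
      map_add' := fun x y => by ext p; simp [Finsupp.ofSupportFinite_coe]
      map_smul' := fun r x => by ext p; simp [Finsupp.ofSupportFinite_coe] }
  refine ⟨(mBasis k).repr.symm.toLinearMap ∘ₗ L, fun p => ?_⟩
  ext c
  rw [coordinate_apply, LinearMap.comp_apply, LinearEquiv.coe_coe, LinearEquiv.apply_symm_apply]
  rfl

variable [Coalgebra k C]

/-- The convolution of functionals concentrated in degrees `i` and `j` is concentrated in degree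
`i + j`. -/
lemma convMul_eq_zero {𝒞 : ℕ → Submodule k C} (h : IsGradedCoalgebra k 𝒞) {i j : ℕ}
    {φ ψ : WithConv (C →ₗ[k] k)} (hφ : ∀ n ≠ i, ∀ c ∈ 𝒞 n, φ c = 0)
    (hψ : ∀ n ≠ j, ∀ c ∈ 𝒞 n, ψ c = 0) : ∀ n ≠ i + j, ∀ c ∈ 𝒞 n, (φ * ψ) c = 0 := by
  intro n hn c hc
  rw [LinearMap.convMul_apply]
  have hle : tensorGrading 𝒞 n ≤
      LinearMap.ker (LinearMap.mul' k k ∘ₗ TensorProduct.map φ.ofConv ψ.ofConv) := by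
    refine tensorGrading_le fun a b hab x hx y hy => ?_
    rw [LinearMap.mem_ker, LinearMap.comp_apply, TensorProduct.map_tmul, LinearMap.mul'_apply]
    -- Since `a + b = n ≠ i + j`, either `a ≠ i` or `b ≠ j`.
    by_cases ha : a = i
    · have : ψ.ofConv y = 0 := hψ b (by omega) y hy
      rw [this, mul_zero]
    · have : φ.ofConv x = 0 := hφ a ha x hx
      rw [this, zero_mul]
  exact hle (h.comul_mem n c hc)

variable [Coalgebra.IsCocomm k C]

/-- The homogeneous components of `ζ` extend multiplicatively from single parts to all partitions,
and the resulting functionals are taken as coordinates. -/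
theorem exists_coalgHom {𝒞 : ℕ → Submodule k C} {ζ : C →ₗ[k] k}
    (h : IsCombinatorialCoalgebra k 𝒞 ζ) : ∃ Ψ : C →ₗc[k] Sym k,
      PreservesGradingAndZeta k 𝒞 ζ (symGrading k) (zetaS k).toLinearMap Ψ.toLinearMap := by
  have htop : iSup 𝒞 = ⊤ := h.isInternal.submodule_iSup_eq_top
  choose Z hZ using exists_homogeneous_component h.isInternal ζ
  -- Cocommutativity enters here: a product over a multiset requires the convolution algebra to be
  -- commutative.
  let F : Multiset ℕ+ → WithConv (C →ₗ[k] k) := fun p => (p.map fun a => toConv (Z a)).prod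
  have F_zero : F 0 = 1 := by simp [F]
  have F_singleton : ∀ a : ℕ+, F {a} = toConv (Z a) := fun a => by simp [F]
  have F_add : ∀ p q, F (p + q) = F p * F q := fun p q => by simp [F]
  have hF : ∀ p, ∀ n ≠ weight p, ∀ c ∈ 𝒞 n, F p c = 0 := by
    intro p
    induction p using Multiset.induction_on with
    | empty =>
      intro n hn c hc
      have : F 0 c = Coalgebra.counit c := by rw [F_zero]; rfl
      exact this.trans (h.counit_eq_zero n hn c hc)
    | cons a s ih =>
      rw [← Multiset.singleton_add, F_add, weight_add]
      refine convMul_eq_zero h.toIsGradedCoalgebra (fun n hn c hc => ?_) ih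
      rw [F_singleton]
      refine (hZ a n c hc).trans (if_neg ?_)
      simpa [weight] using hn
  obtain ⟨Ψ, hΨ⟩ := exists_coordinate_eq htop F hF
  have hmem : ∀ n, ∀ c ∈ 𝒞 n, Ψ c ∈ symGrading k n := by
    intro n c hc
    refine mem_symGrading.mpr fun p hp => ?_
    rw [← coordinate_apply, hΨ]
    exact hF p n hp.symm c hc
  refine ⟨⟨Ψ, ?_, ?_⟩, hmem, ?_⟩
  · ext c
    rw [LinearMap.comp_apply, ← coordinate_zero, hΨ, F_zero]
    rfl
  · rw [map_comp_comul_iff]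
    simp only [hΨ, F_add, implies_true]
  · ext c
    have hc : c ∈ iSup 𝒞 := htop ▸ Submodule.mem_top
    refine Submodule.iSup_induction 𝒞 (motive := fun c => zetaS k (Ψ c) = ζ c) hc
      (fun n c hc => ?_) (by simp) fun x y hx hy => by rw [map_add, map_add, map_add, hx, hy]
    rw [zetaS_apply (hmem n c hc), ← coordinate_apply, hΨ]
    -- Parts are positive, so `Z 0` never occurs in `F`: in degree `0` the relevant coordinate is
    -- the counit, and normalization of `ζ` closes the case.
    rcases n.eq_zero_or_pos with rfl | hn
    · rw [Finsupp.single_zero, shape_zero, F_zero, h.zeta_eq_counit c hc]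
      rfl
    · lift n to ℕ+ using hn
      rw [shape_single_pnat, F_singleton]
      exact (hZ n n c hc).trans (if_pos rfl)

end Existence

/-! ### Uniqueness with prescribed `ζ`, and compatibility with products. -/

section Terminal

variable {k : Type u} [CommRing k]

lemma PreservesGradingAndZeta.coalgHom_unique {C : Type v} [AddCommGroup C] [Module k C]
    [Coalgebra k C] {𝒞 : ℕ → Submodule k C} (h : iSup 𝒞 = ⊤) {ζ : C →ₗ[k] k}
    {Ψ Φ : C →ₗc[k] Sym k}
    (hΨ : PreservesGradingAndZeta k 𝒞 ζ (symGrading k) (zetaS k).toLinearMap Ψ.toLinearMap)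
    (hΦ : PreservesGradingAndZeta k 𝒞 ζ (symGrading k) (zetaS k).toLinearMap Φ.toLinearMap) :
    Ψ = Φ :=
  coalgHom_ext h hΨ.map_mem hΦ.map_mem fun _ c _ =>
    LinearMap.congr_fun (hΨ.zeta_comp.trans hΦ.zeta_comp.symm) c

/-- A morphism of combinatorial coalgebras from a combinatorial Hopf algebra to `Sym` is
multiplicative. -/
lemma map_mul_of_preserves {H : Type v} [Ring H] [HopfAlgebra k H] {ℋ : ℕ → Submodule k H}
    (h : IsGradedConnectedHopfAlgebra k ℋ) {ζ : H →ₐ[k] k} {Ψ : H →ₗc[k] Sym k}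
    (hΨ : PreservesGradingAndZeta k ℋ ζ.toLinearMap (symGrading k) (zetaS k).toLinearMap
      Ψ.toLinearMap) (x y : H) : Ψ (x * y) = Ψ x * Ψ y := by
  have hmem : ∀ n, ∀ c ∈ ℋ n, Ψ c ∈ symGrading k n := hΨ.map_mem
  have hζ : ∀ c, zetaS k (Ψ c) = ζ c := LinearMap.congr_fun hΨ.zeta_comp
  -- The multiplication of a bialgebra is a coalgebra morphism, so the two sides of the claim become
  -- coalgebra morphisms `A` and `B`, to be compared by `coalgHom_ext`.
  let A : H ⊗[k] H →ₗc[k] Sym k := Ψ.comp (Bialgebra.mulCoalgHom k H)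
  let B : H ⊗[k] H →ₗc[k] Sym k :=
    (Bialgebra.mulCoalgHom k (Sym k)).comp (Coalgebra.TensorProduct.map Ψ Ψ)
  have hA : ∀ a b, A (a ⊗ₜ b) = Ψ (a * b) := fun _ _ => rfl
  have hB : ∀ a b, B (a ⊗ₜ b) = Ψ a * Ψ b := fun _ _ => rfl
  have hAB : A = B := by
    refine coalgHom_ext (iSup_tensorGrading h.isInternal.submodule_iSup_eq_top) ?_ ?_ ?_
    · intro n
      refine tensorGrading_le (S := (symGrading k n).comap A.toLinearMap) ?_
      rintro i j rfl a ha b hb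
      exact hmem _ _ (h.mul_mem i j a ha b hb)
    · intro n
      refine tensorGrading_le (S := (symGrading k n).comap B.toLinearMap) ?_
      rintro i j rfl a ha b hb
      exact symGrading_mul_mem (hmem i a ha) (hmem j b hb)
    · intro n z hz
      -- Agreement after `ζ_S` holds on all tensors, because `ζ` and `ζ_S` are multiplicative;
      -- dropping homogeneity allows induction on `z`.
      clear hz
      induction z with
      | zero => simp only [map_zero]
      | add z w hz hw => rw [map_add, map_add, map_add, map_add, hz, hw]
      | tmul a b => rw [hA, hB, map_mul (zetaS k), hζ, hζ, hζ, map_mul]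
  rw [← hA, hAB, hB]

/-- The image of `1` lies in `Sym_0 = k · 1`, and the counit shows that the scalar is `1`. -/
lemma map_one_of_preserves {H : Type v} [Ring H] [HopfAlgebra k H] {ℋ : ℕ → Submodule k H}
    (h : IsGradedConnectedHopfAlgebra k ℋ) {Ψ : H →ₗc[k] Sym k}
    (hΨ : ∀ n, ∀ c ∈ ℋ n, Ψ c ∈ symGrading k n) : Ψ 1 = 1 := by
  have h1 := hΨ 0 1 h.one_mem
  rw [symGrading_zero, Submodule.mem_span_singleton] at h1
  obtain ⟨r, hr⟩ := h1
  have h2 : Coalgebra.counit (R := k) (Ψ 1) = Coalgebra.counit (1 : H) :=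
    CoalgHomClass.counit_comp_apply Ψ 1
  rw [← hr, map_smul, Bialgebra.counit_one, Bialgebra.counit_one, smul_eq_mul, mul_one] at h2
  rw [← hr, h2, one_smul]

end Terminal

end SymFun

/-- `Sym`, with its grading and `ζ_S`, is a cocommutative combinatorial coalgebra and Hopf algebra,
and it is terminal among the cocommutative combinatorial coalgebras and among the cocommutative
combinatorial Hopf algebras. -/
theorem theoremT (k : Type u) [CommRing k] :
    (SymFun.IsGradedConnectedHopfAlgebra k (SymFun.symGrading k) ∧
      SymFun.IsCombinatorialCoalgebra k (SymFun.symGrading k) (SymFun.zetaS k).toLinearMap ∧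
      Coalgebra.IsCocomm k (SymFun.Sym k)) ∧
    (∀ (C : Type v) [AddCommGroup C] [Module k C] [Coalgebra k C] [Coalgebra.IsCocomm k C]
      (𝒞 : ℕ → Submodule k C) (ζ : C →ₗ[k] k), SymFun.IsCombinatorialCoalgebra k 𝒞 ζ →
      ∃! Ψ : C →ₗc[k] SymFun.Sym k,
        SymFun.PreservesGradingAndZeta k 𝒞 ζ (SymFun.symGrading k) (SymFun.zetaS k).toLinearMap
          Ψ.toLinearMap) ∧
    (∀ (H : Type v) [Ring H] [HopfAlgebra k H] [Coalgebra.IsCocomm k H]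
      (ℋ : ℕ → Submodule k H) (ζ : H →ₐ[k] k), SymFun.IsGradedConnectedHopfAlgebra k ℋ →
      ∃! Ψ : H →ₐc[k] SymFun.Sym k,
        SymFun.PreservesGradingAndZeta k ℋ ζ.toLinearMap (SymFun.symGrading k)
          (SymFun.zetaS k).toLinearMap Ψ.toLinearMap) := by
  refine ⟨⟨SymFun.isGradedConnectedHopfAlgebra_sym k,
    (SymFun.isGradedConnectedHopfAlgebra_sym k).isCombinatorialCoalgebra (SymFun.zetaS k),
    SymFun.isCocomm_sym⟩, ?_, ?_⟩
  · intro C _ _ _ _ 𝒞 ζ h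
    obtain ⟨Ψ, hΨ⟩ := SymFun.exists_coalgHom h
    exact ⟨Ψ, hΨ, fun Φ hΦ => hΦ.coalgHom_unique h.isInternal.submodule_iSup_eq_top hΨ⟩
  · intro H _ _ _ ℋ ζ h
    obtain ⟨Ψ, hΨ⟩ := SymFun.exists_coalgHom (h.isCombinatorialCoalgebra ζ)
    refine ⟨{ Ψ with
      map_one' := SymFun.map_one_of_preserves h hΨ.map_mem
      map_mul' := SymFun.map_mul_of_preserves h hΨ }, hΨ, fun Φ hΦ => ?_⟩
    -- Uniqueness already holds after forgetting the multiplication.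
    have key : Φ.toCoalgHom = Ψ :=
      SymFun.PreservesGradingAndZeta.coalgHom_unique h.isInternal.submodule_iSup_eq_top hΦ hΨ
    refine BialgHom.ext fun x => ?_
    exact congrArg (fun L : H →ₗc[k] SymFun.Sym k => L x) key
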